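/- Order $\mathbb{N}^2$ componentwise, and let $\min$ denote the componentwise minimum. A submonoid $T$ of $(\mathbb{N}^2,+)$ is a \emph{good semigroup} if (G1) $\min(\alpha,\beta)\in T$ for all $\alpha,\beta\in T$; (G2) $\delta+\mathbb{N}^2\subseteq T$ for some $\delta\in\mathbb{N}^2$; (G3) if $\alpha\ne\beta$ are in $T$ and $\alpha_i=\beta_i$ for some $i\in\{1,2\}$, then there is $\epsilon\in T$ with $\epsilon_i>\alpha_i=\beta_i$ and $\epsilon_j\ge\min\{\alpha_j,\beta_j\}$ for $j\neq i$, with equality if $\alpha_j\ne\beta_j$. For $E\subseteq\mathbb{N}^2$ and $\alpha,\beta\in E$, a saturated chain of length $n$ from $\alpha$ to $\beta$ in $E$ is a sequence $\alpha=\alpha^{(0)}<\dots<\alpha^{(n)}=\beta$ of elements of $E$ with no element of $E$ strictly between two successive ones. Write $d_E(\alpha,\beta)$ for the common length of all such chains (when such chains exist and all have the same length). The \emph{genus} of $T$ is $$g(T)=d(\mathbb{N}^2\setminus T):=d_{\mathbb{N}^2}(\mathbf 0,\alpha)-d_T(\mathbf 0,\alpha),$$ where $\alpha\in\mathbb{N}^2$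 is any element with $\alpha+\mathbb{N}^2\subseteq T$. Write $\alpha\ll\beta$ if $\alpha_1<\beta_1$ and $\alpha_2<\beta_2$, and $\alpha\leq\leq\beta$ if $\alpha=\beta$ or $\alpha\ll\beta$. For $A\subseteq\mathbb{N}^2$ such that $c+\mathbb{N}^2\subseteq\mathbb{N}^2\setminus A$ for some $c\in\mathbb{N}^2$, put $D^{(0)}=\emptyset$ and, for $i\ge1$, let $B^{(i)}$ be the set of $\leq\leq$-maximal elements of $A\setminus\bigcup_{j<i}D^{(j)}$, let $C^{(i)}$ be the set of those $\alpha\in B^{(i)}$ with $\alpha=\min(\beta_1,\beta_2)$ for some $\beta_1,\beta_2\in B^{(i)}\setminus\{\alpha\}$, and let $D^{(i)}=B^{(i)}\setminus C^{(i)}$. The \emph{number of levels} $\operatorname{NL}(A)$ is the integer $N\ge 0$ such that $A$ is the disjoint union of the nonempty sets (levels) $A_i=D^{(N+1-i)}$, $1\le i\le N$. \textbf{Corollary.} For every good semigroup $T\subseteq\mathbb{N}^2$, the numbers $g(T)$ and $\operatorname{NL}(\mathbb{N}^2\setminus T)$ are well defined (in particular, $g(T)$ does not depend on $\alpha$), and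 $$g(T)=\operatorname{NL}(\mathbb{N}^2\setminus T).$$ -/

import Mathlib

open Set

/-- A submonoid `S` of `ℕ²` is a good semigroup. The order and the infimum `⊓` on `ℕ × ℕ` are the
componentwise ones. -/
structure IsGoodSemigroup (S : AddSubmonoid (ℕ × ℕ)) : Prop where
  /-- (G1) closure under componentwise minimum -/
  inf_mem : ∀ α ∈ S, ∀ β ∈ S, α ⊓ β ∈ S
  /-- (G2) `S` contains a translated quadrant -/
  exists_cone : ∃ δ : ℕ × ℕ, ∀ β : ℕ × ℕ, δ + β ∈ S
  /-- (G3) for the first coordinate -/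
  exchange_fst : ∀ α ∈ S, ∀ β ∈ S, α ≠ β → α.1 = β.1 →
    ∃ ε ∈ S, α.1 < ε.1 ∧ min α.2 β.2 ≤ ε.2 ∧ (α.2 ≠ β.2 → ε.2 = min α.2 β.2)
  /-- (G3) for the second coordinate -/
  exchange_snd : ∀ α ∈ S, ∀ β ∈ S, α ≠ β → α.2 = β.2 →
    ∃ ε ∈ S, α.2 < ε.2 ∧ min α.1 β.1 ≤ ε.1 ∧ (α.1 ≠ β.1 → ε.1 = min α.1 β.1)

/-- There is a saturated chain `α = a 0 < a 1 < ⋯ < a n = β` of length `n` in `E`: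
all its members lie in `E` and no element of `E` lies strictly between two successive ones. -/
def HasSaturatedChain (E : Set (ℕ × ℕ)) (α β : ℕ × ℕ) (n : ℕ) : Prop :=
  ∃ a : ℕ → ℕ × ℕ, a 0 = α ∧ a n = β ∧ (∀ i ≤ n, a i ∈ E) ∧
    ∀ i < n, a i < a (i + 1) ∧ ¬ ∃ γ ∈ E, a i < γ ∧ γ < a (i + 1)

/-- `d_E(α, β) = n`: saturated chains in `E` from `α` to `β` exist, and `n` is their common
length. -/
def IsChainDist (E : Set (ℕ × ℕ)) (α β : ℕ × ℕ) (n : ℕ) : Prop :=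
  HasSaturatedChain E α β n ∧ ∀ m, HasSaturatedChain E α β m → m = n

/-- `d(E ∖ F) = k`: with `e`, `f` the minima of `E`, `F`, one has
`d_E(e, α) - d_F(f, α) = k` for all `α` so large that the quadrant above `α` lies in both sets
(and there are such `α`). -/
def IsSetDist (E F : Set (ℕ × ℕ)) (k : ℤ) : Prop :=
  ∃ e f : ℕ × ℕ, IsLeast E e ∧ IsLeast F f ∧ (∃ α, Ici α ⊆ E ∩ F) ∧
    ∀ α, Ici α ⊆ E ∩ F →
      ∃ m n : ℕ, IsChainDist E e α m ∧ IsChainDist F f α n ∧ (m : ℤ) - (n : ℤ) = k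

/-- The distance `d(E ∖ F)`: the number `k` with `IsSetDist E F k`. -/
noncomputable def setDist (E F : Set (ℕ × ℕ)) : ℤ :=
  Classical.epsilon (IsSetDist E F)

/-- The genus `g(S) = d(ℕ² ∖ S)`. -/
noncomputable def genus (S : AddSubmonoid (ℕ × ℕ)) : ℤ :=
  setDist univ (S : Set (ℕ × ℕ))

/-- The strict relation `α ≪ β`: strictly smaller in both coordinates. -/
def StrictBoth (α β : ℕ × ℕ) : Prop := α.1 < β.1 ∧ α.2 < β.2

/-- The partial order `α ≤≤ β`: `α = β` or `α ≪ β`. -/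
def LeLe (α β : ℕ × ℕ) : Prop := α = β ∨ StrictBoth α β

/-- The elements of `X` that are maximal in `X` with respect to `≤≤`. -/
def maxPart (X : Set (ℕ × ℕ)) : Set (ℕ × ℕ) :=
  {α | α ∈ X ∧ ∀ β ∈ X, LeLe α β → β = α}

/-- The elements of `B` that are the componentwise minimum of two other elements of `B`. -/
def meetPart (B : Set (ℕ × ℕ)) : Set (ℕ × ℕ) :=
  {α | α ∈ B ∧ ∃ β₁ ∈ B \ {α}, ∃ β₂ ∈ B \ {α}, α = β₁ ⊓ β₂}

/-- The sets `D⁽ⁱ⁾` attached to `A`: `D⁽⁰⁾ = ∅`, and `D⁽ⁱ⁾ = B⁽ⁱ⁾ ∖ C⁽ⁱ⁾` for `i ≥ 1`, where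
`B⁽ⁱ⁾` is the set of `≤≤`-maximal elements of `A ∖ ⋃_{j < i} D⁽ʲ⁾` and `C⁽ⁱ⁾` is the set of
elements of `B⁽ⁱ⁾` that are minima of two other elements of `B⁽ⁱ⁾`. -/
def layer (A : Set (ℕ × ℕ)) : ℕ → Set (ℕ × ℕ)
  | 0 => ∅
  | i + 1 =>
    maxPart (A \ ⋃ j : Fin (i + 1), layer A j) \
      meetPart (maxPart (A \ ⋃ j : Fin (i + 1), layer A j))
  decreasing_by all_goals exact j.isLt

/-- The `i`-th level `A_i = D⁽ᴺ⁺¹⁻ⁱ⁾` (`1 ≤ i ≤ N`) of a set `A` with `N` levels. -/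
def level (A : Set (ℕ × ℕ)) (N i : ℕ) : Set (ℕ × ℕ) := layer A (N + 1 - i)

/-- `A` is partitioned into its levels `A_1, …, A_N` (nonempty and pairwise disjoint). -/
def IsLevelNumber (A : Set (ℕ × ℕ)) (N : ℕ) : Prop :=
  A = ⋃ i ∈ Icc 1 N, level A N i ∧
    (∀ i ∈ Icc 1 N, (level A N i).Nonempty) ∧
    (Icc 1 N).PairwiseDisjoint (level A N)

/-- The number of levels `NL(A)`: the number `N` with `IsLevelNumber A N`. -/
noncomputable def numLevels (A : Set (ℕ × ℕ)) : ℕ :=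
  Classical.epsilon (IsLevelNumber A)

/-! Both numbers equal one potential evaluated at the origin. Walk from `(a, b)` into the cone above
`D`, paying 1 for each step right whose upward ray misses `T` and for each step up whose rightward
ray misses `T`. By (G3) the cost does not depend on the path (`gap_square`), so `gapCount` is a
function on ℕ² with known one-step differences.

On `T`, `|α| + gapCount α` is a rank function (`rank_step`). Since the count vanishes at every apex
of a cone in `T`, the genus is `gapCount 0 0`. On the gaps, the count is the index of the layer
(`layer_compl`) and takes exactly the values `1, …, gapCount 0 0` (`exists_gapCount_eq`), so this is
also the number of levels. -/

/-- `0` if `T` meets the vertical ray going up from `(a, b)`, and `1` otherwise. -/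
noncomputable def verticalGap (T : Set (ℕ × ℕ)) (a b : ℕ) : ℕ :=
  open Classical in if ∃ y, b ≤ y ∧ (a, y) ∈ T then 0 else 1

/-- `0` if `T` meets the horizontal ray going right from `(a, b)`, and `1` otherwise. -/
noncomputable def horizontalGap (T : Set (ℕ × ℕ)) (a b : ℕ) : ℕ :=
  open Classical in if ∃ x, a ≤ x ∧ (x, b) ∈ T then 0 else 1

/-- The number of gaps of `T` met by a lattice path from `(a, b)` into the cone above `D`. -/
noncomputable def gapCount (T : Set (ℕ × ℕ)) (D : ℕ × ℕ) (a b : ℕ) : ℕ :=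
  ∑ x ∈ Finset.Ico a D.1, verticalGap T x b + ∑ y ∈ Finset.Ico b D.2, horizontalGap T D.1 y

section Gaps

variable {T : Set (ℕ × ℕ)} {a b : ℕ}

theorem verticalGap_eq_zero (h : ∃ y, b ≤ y ∧ (a, y) ∈ T) : verticalGap T a b = 0 := if_pos h

theorem verticalGap_eq_one (h : ¬ ∃ y, b ≤ y ∧ (a, y) ∈ T) : verticalGap T a b = 1 := if_neg h

theorem horizontalGap_eq_zero (h : ∃ x, a ≤ x ∧ (x, b) ∈ T) : horizontalGap T a b = 0 := if_pos h

theorem horizontalGap_eq_one (h : ¬ ∃ x, a ≤ x ∧ (x, b) ∈ T) : horizontalGap T a b = 1 := if_neg h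

theorem verticalGap_le_one : verticalGap T a b ≤ 1 := by
  unfold verticalGap; split_ifs <;> simp

theorem horizontalGap_le_one : horizontalGap T a b ≤ 1 := by
  unfold horizontalGap; split_ifs <;> simp

theorem verticalGap_succ_of_notMem (h : (a, b) ∉ T) :
    verticalGap T a (b + 1) = verticalGap T a b := by
  by_cases h1 : ∃ y, b ≤ y ∧ (a, y) ∈ T
  · obtain ⟨y, hy, hT⟩ := h1
    have : b ≠ y := by rintro rfl; exact h hT
    rw [verticalGap_eq_zero ⟨y, hy, hT⟩, verticalGap_eq_zero ⟨y, by omega, hT⟩]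
  · rw [verticalGap_eq_one h1, verticalGap_eq_one]
    rintro ⟨y, hy, hT⟩
    exact h1 ⟨y, by omega, hT⟩

theorem horizontalGap_succ_of_notMem (h : (a, b) ∉ T) :
    horizontalGap T (a + 1) b = horizontalGap T a b := by
  by_cases h1 : ∃ x, a ≤ x ∧ (x, b) ∈ T
  · obtain ⟨x, hx, hT⟩ := h1
    have : a ≠ x := by rintro rfl; exact h hT
    rw [horizontalGap_eq_zero ⟨x, hx, hT⟩, horizontalGap_eq_zero ⟨x, by omega, hT⟩]
  · rw [horizontalGap_eq_one h1, horizontalGap_eq_one]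
    rintro ⟨x, hx, hT⟩
    exact h1 ⟨x, by omega, hT⟩

end Gaps

/-! ### Path independence and monotonicity of the gap count. -/

namespace IsGoodSemigroup

variable {T : AddSubmonoid (ℕ × ℕ)} {D : ℕ × ℕ} {a b : ℕ}

theorem top : IsGoodSemigroup (⊤ : AddSubmonoid (ℕ × ℕ)) where
  inf_mem := by simp
  exists_cone := by simp
  exchange_fst := by
    intro α _ β _ _ _
    exact ⟨(α.1 + 1, min α.2 β.2), by simp, by simp, by simp, by simp⟩
  exchange_snd := by
    intro α _ β _ _ _
    exact ⟨(min α.1 β.1, α.2 + 1), by simp, by simp, by simp, by simp⟩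

theorem mem_of_gap_eq_zero (hT : IsGoodSemigroup T)
    (hv : verticalGap (T : Set (ℕ × ℕ)) a b = 0) (hh : horizontalGap (T : Set (ℕ × ℕ)) a b = 0) :
    (a, b) ∈ T := by
  by_contra hab
  by_cases h1 : ∃ y, b ≤ y ∧ (a, y) ∈ (T : Set (ℕ × ℕ))
  · by_cases h2 : ∃ x, a ≤ x ∧ (x, b) ∈ (T : Set (ℕ × ℕ))
    · obtain ⟨y, hy, h1⟩ := h1
      obtain ⟨x, hx, h2⟩ := h2
      have := hT.inf_mem _ h1 _ h2
      simp [Prod.mk_inf_mk, hx, hy] at this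
      exact hab this
    · rw [horizontalGap_eq_one h2] at hh; omega
  · rw [verticalGap_eq_one h1] at hv; omega

/-- The two ways around a unit square cost the same. If `(a, b) ∈ T`, (G3) turns a further point of
`T` on one ray into a further point on the other; if `(a, b) ∉ T`, moving the start of a ray past it
changes nothing. -/
theorem gap_square (hT : IsGoodSemigroup T) (a b : ℕ) :
    verticalGap (T : Set (ℕ × ℕ)) a b + horizontalGap (T : Set (ℕ × ℕ)) (a + 1) b =
      horizontalGap (T : Set (ℕ × ℕ)) a b + verticalGap (T : Set (ℕ × ℕ)) a (b + 1) := by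
  by_cases hab : (a, b) ∈ (T : Set (ℕ × ℕ))
  · rw [verticalGap_eq_zero ⟨b, le_rfl, hab⟩, horizontalGap_eq_zero ⟨a, le_rfl, hab⟩]
    by_cases h1 : ∃ x, a + 1 ≤ x ∧ (x, b) ∈ (T : Set (ℕ × ℕ))
    · rw [horizontalGap_eq_zero h1, verticalGap_eq_zero]
      obtain ⟨x, hx, h⟩ := h1
      obtain ⟨⟨p, q⟩, hε, h2, -, h3⟩ := hT.exchange_snd _ hab _ h (by simp; omega) rfl
      have h3 : p = min a x := h3 (by simp; omega)
      have : p = a := by omega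
      subst this
      exact ⟨q, h2, hε⟩
    · rw [horizontalGap_eq_one h1, verticalGap_eq_one]
      rintro ⟨y, hy, h⟩
      obtain ⟨⟨p, q⟩, hε, h2, -, h3⟩ := hT.exchange_fst _ hab _ h (by simp; omega) rfl
      have h3 : q = min b y := h3 (by simp; omega)
      have : q = b := by omega
      subst this
      exact h1 ⟨p, h2, hε⟩
  · rw [horizontalGap_succ_of_notMem hab, verticalGap_succ_of_notMem hab, add_comm]

theorem gapCount_fst (hD : ∀ β, D + β ∈ T) (a b : ℕ) :
    gapCount (T : Set (ℕ × ℕ)) D a b =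
      gapCount (T : Set (ℕ × ℕ)) D (a + 1) b + verticalGap (T : Set (ℕ × ℕ)) a b := by
  unfold gapCount
  by_cases h : a < D.1
  · rw [Finset.sum_eq_sum_Ico_succ_bot h]
    omega
  -- Here the sums over columns are empty, and the vertical ray enters the cone above `D`.
  · have hm := hD (a - D.1, b)
    have : D + (a - D.1, b) = (a, D.2 + b) := by ext <;> simp; omega
    rw [this] at hm
    rw [verticalGap_eq_zero ⟨_, by omega, hm⟩, Finset.Ico_eq_empty (a := a) (by omega),
      Finset.Ico_eq_empty (a := a + 1) (by omega)]
    simp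

theorem horizontalGap_eq_of_le (hT : IsGoodSemigroup T) (hD : ∀ β, D + β ∈ T) (h : D.1 ≤ a) :
    horizontalGap (T : Set (ℕ × ℕ)) a b = horizontalGap (T : Set (ℕ × ℕ)) D.1 b := by
  have hv (x : ℕ) (hx : D.1 ≤ x) (y : ℕ) : verticalGap (T : Set (ℕ × ℕ)) x y = 0 := by
    have := gapCount_fst hD x y
    unfold gapCount at this
    rw [Finset.Ico_eq_empty (a := x) (by omega),
      Finset.Ico_eq_empty (a := x + 1) (by omega)] at this
    simpa using this
  induction a, h using Nat.le_induction with
  | base => rfl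
  | succ x hx ih =>
    have := hT.gap_square x b
    rw [hv x hx, hv x hx] at this
    omega

/-- Clear in the columns from `D.1` on; `gap_square` carries it leftwards one column at a time. -/
theorem gapCount_snd (hT : IsGoodSemigroup T) (hD : ∀ β, D + β ∈ T) (a b : ℕ) :
    gapCount (T : Set (ℕ × ℕ)) D a b =
      gapCount (T : Set (ℕ × ℕ)) D a (b + 1) + horizontalGap (T : Set (ℕ × ℕ)) a b := by
  have base (x : ℕ) (hx : D.1 ≤ x) : gapCount (T : Set (ℕ × ℕ)) D x b =
      gapCount (T : Set (ℕ × ℕ)) D x (b + 1) + horizontalGap (T : Set (ℕ × ℕ)) x b := by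
    rw [hT.horizontalGap_eq_of_le hD hx]
    unfold gapCount
    rw [Finset.Ico_eq_empty (a := x) (by omega)]
    by_cases hb : b < D.2
    · rw [Finset.sum_eq_sum_Ico_succ_bot hb]
      simp; omega
    · have hm := hD (0, b - D.2)
      have : D + (0, b - D.2) = (D.1, b) := by ext <;> simp; omega
      rw [this] at hm
      rw [horizontalGap_eq_zero ⟨_, le_rfl, hm⟩, Finset.Ico_eq_empty (a := b) (by omega),
        Finset.Ico_eq_empty (a := b + 1) (by omega)]
      simp
  obtain h | h := le_total D.1 a
  · exact base a h
  · induction h using Nat.decreasingInduction with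
    | self => exact base _ le_rfl
    | of_succ x hx ih =>
      have := hT.gap_square x b
      have := gapCount_fst hD x b
      have := gapCount_fst hD x (b + 1)
      omega

theorem gapCount_anti (hT : IsGoodSemigroup T) (hD : ∀ β, D + β ∈ T) {a' b' : ℕ}
    (ha : a ≤ a') (hb : b ≤ b') :
    gapCount (T : Set (ℕ × ℕ)) D a' b' ≤ gapCount (T : Set (ℕ × ℕ)) D a b := by
  have h1 : gapCount (T : Set (ℕ × ℕ)) D a' b ≤ gapCount (T : Set (ℕ × ℕ)) D a b := by
    induction a', ha using Nat.le_induction with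
    | base => rfl
    | succ x hx ih => have := gapCount_fst hD x b; omega
  refine le_trans ?_ h1
  induction b', hb using Nat.le_induction with
  | base => rfl
  | succ y hy ih => have := hT.gapCount_snd hD a' y; omega

theorem one_le_gaps_of_notMem (hT : IsGoodSemigroup T)
    (h : (a, b) ∉ T) : 1 ≤ verticalGap (T : Set (ℕ × ℕ)) a b +
      horizontalGap (T : Set (ℕ × ℕ)) a b := by
  by_contra h'
  exact h (hT.mem_of_gap_eq_zero (by omega) (by omega))

/-- Outside `T`, a diagonal step decreases the count by the number of missed rays. -/
theorem gapCount_diag (hT : IsGoodSemigroup T) (hD : ∀ β, D + β ∈ T) (h : (a, b) ∉ T) :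
    gapCount (T : Set (ℕ × ℕ)) D a b = gapCount (T : Set (ℕ × ℕ)) D (a + 1) (b + 1) +
      verticalGap (T : Set (ℕ × ℕ)) a b + horizontalGap (T : Set (ℕ × ℕ)) a b := by
  have := gapCount_fst hD a b
  have := hT.gapCount_snd hD (a + 1) b
  have := horizontalGap_succ_of_notMem (T := (T : Set (ℕ × ℕ))) h
  omega

theorem gapCount_lt_of_notMem (hT : IsGoodSemigroup T) (hD : ∀ β, D + β ∈ T) (h : (a, b) ∉ T) :
    gapCount (T : Set (ℕ × ℕ)) D (a + 1) (b + 1) < gapCount (T : Set (ℕ × ℕ)) D a b := by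
  have := hT.gapCount_diag hD h
  have := hT.one_le_gaps_of_notMem h
  omega

/-- Every value of the count between `1` and its value at `(a, b)` is attained at a gap
above `(a, b)`. -/
theorem exists_gapCount_eq (hT : IsGoodSemigroup T) (hD : ∀ β, D + β ∈ T) {i : ℕ} (hi : 1 ≤ i)
    (h : i ≤ gapCount (T : Set (ℕ × ℕ)) D a b) :
    ∃ x y, a ≤ x ∧ b ≤ y ∧ (x, y) ∉ T ∧ gapCount (T : Set (ℕ × ℕ)) D x y = i := by
  induction hn : (D.1 - a) + (D.2 - b) using Nat.strong_induction_on generalizing a b with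
  | _ n ih =>
    have h1 := gapCount_fst hD a b
    have h2 := hT.gapCount_snd hD a b
    by_cases hab : (a, b) ∉ T ∧ gapCount (T : Set (ℕ × ℕ)) D a b = i
    · exact ⟨a, b, le_rfl, le_rfl, hab⟩
    by_cases ha : a < D.1
    · have : i ≤ gapCount (T : Set (ℕ × ℕ)) D (a + 1) b := by
        -- One step lowers the count by at most 1, so dropping below `i` means that the count here
        -- is `i` and the ray misses `T`; then `(a, b)` itself is the required gap.
        by_contra hlt
        have := verticalGap_le_one (T := (T : Set (ℕ × ℕ))) (a := a) (b := b)
        refine hab ⟨fun hm ↦ ?_, by omega⟩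
        have := verticalGap_eq_zero (T := (T : Set (ℕ × ℕ))) ⟨b, le_rfl, hm⟩
        omega
      obtain ⟨x, y, hx, hy, hxy⟩ := ih _ (by omega) this rfl
      exact ⟨x, y, by omega, hy, hxy⟩
    by_cases hb : b < D.2
    · have : i ≤ gapCount (T : Set (ℕ × ℕ)) D a (b + 1) := by
        by_contra hlt
        have := horizontalGap_le_one (T := (T : Set (ℕ × ℕ))) (a := a) (b := b)
        refine hab ⟨fun hm ↦ ?_, by omega⟩
        have := horizontalGap_eq_zero (T := (T : Set (ℕ × ℕ))) ⟨a, le_rfl, hm⟩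
        omega
      obtain ⟨x, y, hx, hy, hxy⟩ := ih _ (by omega) this rfl
      exact ⟨x, y, hx, by omega, hxy⟩
    · rw [gapCount, Finset.Ico_eq_empty (by omega), Finset.Ico_eq_empty (by omega)] at h
      simp at h
      omega

theorem gapCount_eq_zero (hT : IsGoodSemigroup T) (hD : ∀ β, D + β ∈ T)
    (h : Ici (a, b) ⊆ (T : Set (ℕ × ℕ))) : gapCount (T : Set (ℕ × ℕ)) D a b = 0 := by
  by_contra hne
  obtain ⟨x, y, hx, hy, hxy, -⟩ := hT.exists_gapCount_eq hD le_rfl (Nat.one_le_iff_ne_zero.2 hne)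
  exact hxy (h (Prod.mk_le_mk.2 ⟨hx, hy⟩))

/-! ### Saturated chains and the rank function. -/

/-- One step of a saturated chain in `T` increases `|α| + gapCount α` by `1`. -/
theorem rank_step (hT : IsGoodSemigroup T) (hD : ∀ β, D + β ∈ T) {α β : ℕ × ℕ} (hα : α ∈ T)
    (hβ : β ∈ T) (hlt : α < β) (hsat : ¬ ∃ γ ∈ (T : Set (ℕ × ℕ)), α < γ ∧ γ < β) :
    β.1 + β.2 + gapCount (T : Set (ℕ × ℕ)) D β.1 β.2 =
      α.1 + α.2 + gapCount (T : Set (ℕ × ℕ)) D α.1 α.2 + 1 := by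
  obtain ⟨a, b⟩ := α
  obtain ⟨c, d⟩ := β
  obtain ⟨hac, hbd⟩ : a ≤ c ∧ b ≤ d := Prod.mk_le_mk.1 hlt.le
  have hne : a ≠ c ∨ b ≠ d := by
    by_contra! h
    exact hlt.ne (Prod.ext h.1 h.2)
  -- By (G1), a suitable point of `T` on a ray crossed between `α` and `β` would have its minimum
  -- with `β` strictly between them. So every ray after the first misses `T`, and each unit of
  -- length is offset by a drop of 1 in the count; only the first step, from `α ∈ T`, is free.
  have key (x y : ℕ) (h : (x, y) ∈ T) (hx : a ≤ x) (hy : b ≤ y) (h1 : a < min x c ∨ b < min y d)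
      (h2 : x < c ∨ y < d) : False := by
    refine hsat ⟨_, hT.inf_mem _ h _ hβ, ?_, ?_⟩ <;> rw [Prod.lt_iff] <;> simp <;> omega
  have vert (x y : ℕ) (hx : a ≤ x) (hxc : x = c) (hby : b ≤ y) (hyd : y ≤ d)
      (h : a < c ∨ b < y) (y' : ℕ) (hy' : y ≤ y') (hy'd : y' ≤ d) :
      y' + gapCount (T : Set (ℕ × ℕ)) D x y' = y + gapCount (T : Set (ℕ × ℕ)) D x y := by
    induction y', hy' using Nat.le_induction with
    | base => rfl
    | succ z hz ih =>
      have h1 := hT.gapCount_snd hD x z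
      rw [horizontalGap_eq_one] at h1
      · have := ih (by omega); omega
      · rintro ⟨w, hw, hm⟩
        exact key w z hm (by omega) (by omega) (by omega) (by omega)
  by_cases h : a < c
  · have h1 := gapCount_fst hD a b
    rw [verticalGap_eq_zero ⟨b, le_rfl, hα⟩] at h1
    have horiz (x : ℕ) (hx : a + 1 ≤ x) (hxc : x ≤ c) :
        x + gapCount (T : Set (ℕ × ℕ)) D x b =
          a + 1 + gapCount (T : Set (ℕ × ℕ)) D (a + 1) b := by
      induction x, hx using Nat.le_induction with
      | base => rfl
      | succ z hz ih =>
        have h1 := gapCount_fst hD z b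
        rw [verticalGap_eq_one] at h1
        · have := ih (by omega); omega
        · rintro ⟨w, hw, hm⟩
          exact key z w hm (by omega) (by omega) (by omega) (by omega)
    have h2 := horiz c (by omega) le_rfl
    have h3 := vert c b hac rfl le_rfl hbd (Or.inl h) d hbd le_rfl
    simp only
    omega
  · obtain rfl : a = c := by omega
    have h1 := hT.gapCount_snd hD a b
    rw [horizontalGap_eq_zero ⟨a, le_rfl, hα⟩] at h1
    have h3 := vert a (b + 1) hac rfl (by omega) (by omega) (Or.inr (by omega)) d (by omega) le_rfl
    simp only
    omega

theorem rank_of_hasSaturatedChain (hT : IsGoodSemigroup T) (hD : ∀ β, D + β ∈ T) {α β : ℕ × ℕ}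
    {n : ℕ} (h : HasSaturatedChain (T : Set (ℕ × ℕ)) α β n) :
    β.1 + β.2 + gapCount (T : Set (ℕ × ℕ)) D β.1 β.2 =
      α.1 + α.2 + gapCount (T : Set (ℕ × ℕ)) D α.1 α.2 + n := by
  obtain ⟨c, rfl, rfl, hc, hs⟩ := h
  have (k : ℕ) (hk : k ≤ n) :
      (c k).1 + (c k).2 + gapCount (T : Set (ℕ × ℕ)) D (c k).1 (c k).2 =
        (c 0).1 + (c 0).2 + gapCount (T : Set (ℕ × ℕ)) D (c 0).1 (c 0).2 + k := by
    induction k with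
    | zero => rfl
    | succ k ih =>
      have := ih (by omega)
      have := hT.rank_step hD (hc k (by omega)) (hc (k + 1) hk) (hs k hk).1 (hs k hk).2
      omega
  exact this n le_rfl

end IsGoodSemigroup

theorem exists_hasSaturatedChain {E : Set (ℕ × ℕ)} {α β : ℕ × ℕ} (hα : α ∈ E) (hβ : β ∈ E)
    (h : α ≤ β) : ∃ n, HasSaturatedChain E α β n := by
  induction hn : (β.1 - α.1) + (β.2 - α.2) using Nat.strong_induction_on generalizing α with
  | _ n ih =>
    obtain rfl | hlt := h.eq_or_lt
    · exact ⟨0, fun _ ↦ α, rfl, rfl, fun _ _ ↦ hα, by simp⟩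
    obtain ⟨γ, ⟨hγ, hαγ, hγβ⟩, hmin⟩ := (wellFounded_lt (α := ℕ × ℕ)).has_min
      {γ | γ ∈ E ∧ α < γ ∧ γ ≤ β} ⟨β, hβ, hlt, le_rfl⟩
    obtain ⟨m, c, h0, hm, hc, hs⟩ := ih _ (by
      rw [Prod.lt_iff] at hαγ
      rw [Prod.le_def] at hγβ
      omega) hγ hγβ rfl
    refine ⟨m + 1, fun i ↦ Nat.casesOn i α c, rfl, hm, ?_, ?_⟩
    · rintro (_ | i) hi
      · exact hα
      · exact hc i (by omega)
    · rintro (_ | i) hi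
      · change α < c 0 ∧ ¬ ∃ δ ∈ E, α < δ ∧ δ < c 0
        rw [h0]
        refine ⟨hαγ, ?_⟩
        rintro ⟨δ, hδ, h1, h2⟩
        exact hmin δ ⟨hδ, h1, h2.le.trans hγβ⟩ h2
      · exact hs i (by omega)

/-! ### The genus and the layers in terms of the gap count. -/

namespace IsGoodSemigroup

variable {T : AddSubmonoid (ℕ × ℕ)} {D : ℕ × ℕ}

theorem exists_isChainDist (hT : IsGoodSemigroup T) (hD : ∀ β, D + β ∈ T) {α : ℕ × ℕ}
    (h : Ici α ⊆ (T : Set (ℕ × ℕ))) :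
    ∃ n, IsChainDist (T : Set (ℕ × ℕ)) 0 α n ∧
      α.1 + α.2 = gapCount (T : Set (ℕ × ℕ)) D 0 0 + n := by
  obtain ⟨n, hn⟩ := exists_hasSaturatedChain (E := (T : Set (ℕ × ℕ))) T.zero_mem
    (h self_mem_Ici) zero_le
  have hα := hT.gapCount_eq_zero hD (a := α.1) (b := α.2) h
  have key {m : ℕ} (hm : HasSaturatedChain (T : Set (ℕ × ℕ)) 0 α m) :
      α.1 + α.2 = gapCount (T : Set (ℕ × ℕ)) D 0 0 + m := by
    have := hT.rank_of_hasSaturatedChain hD hm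
    simp only [Prod.fst_zero, Prod.snd_zero] at this
    omega
  refine ⟨n, ⟨hn, fun m hm ↦ ?_⟩, key hn⟩
  have := key hm
  have := key hn
  omega

theorem isChainDist_univ (α : ℕ × ℕ) : IsChainDist univ 0 α (α.1 + α.2) := by
  -- ℕ² is itself a good semigroup, with count 0 at the origin.
  obtain ⟨n, hn, h⟩ := top.exists_isChainDist (D := 0) (by simp) (α := α) (by simp)
  have h0 : gapCount ((⊤ : AddSubmonoid (ℕ × ℕ)) : Set (ℕ × ℕ)) 0 0 0 = 0 :=
    top.gapCount_eq_zero (by simp) (by simp)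
  rw [h0, zero_add] at h
  rw [h]
  simpa using hn

theorem isSetDist (hT : IsGoodSemigroup T) (hD : ∀ β, D + β ∈ T) :
    IsSetDist univ (T : Set (ℕ × ℕ)) (gapCount (T : Set (ℕ × ℕ)) D 0 0 : ℕ) := by
  refine ⟨0, 0, ⟨mem_univ _, fun _ _ ↦ zero_le⟩, ⟨T.zero_mem, fun _ _ ↦ zero_le⟩,
    ⟨D, fun β hβ ↦ ⟨mem_univ _, ?_⟩⟩, fun α hα ↦ ?_⟩
  · obtain ⟨γ, rfl⟩ := exists_add_of_le (mem_Ici.1 hβ)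
    exact hD γ
  · obtain ⟨n, hn, h⟩ := hT.exists_isChainDist hD (hα.trans inter_subset_right)
    exact ⟨_, n, isChainDist_univ α, hn, by omega⟩

/-- The `i`-th layer of the complement of `T` consists of the gaps with count `i`. -/
theorem layer_compl (hT : IsGoodSemigroup T) (hD : ∀ β, D + β ∈ T) (i : ℕ) :
    layer (univ \ (T : Set (ℕ × ℕ))) i =
      {α | α ∉ T ∧ gapCount (T : Set (ℕ × ℕ)) D α.1 α.2 = i} := by
  induction i using Nat.strong_induction_on with
  | _ i ih =>
    obtain _ | i := i
    · rw [layer]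
      ext ⟨a, b⟩
      simp only [mem_empty_iff_false, mem_ofPred_eq, false_iff, not_and]
      intro h
      have := hT.gapCount_lt_of_notMem hD h
      omega
    · have hX : (univ \ (T : Set (ℕ × ℕ))) \
          ⋃ j : Fin (i + 1), layer (univ \ (T : Set (ℕ × ℕ))) j =
          {α | α ∉ T ∧ i + 1 ≤ gapCount (T : Set (ℕ × ℕ)) D α.1 α.2} := by
        ext α
        simp only [mem_sdiff, mem_univ, true_and, mem_iUnion, not_exists, mem_ofPred_eq,
          SetLike.mem_coe]
        refine and_congr_right fun hα ↦ ⟨fun h ↦ ?_, fun h j hj ↦ ?_⟩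
        · by_contra hlt
          refine h ⟨_, not_le.1 hlt⟩ ?_
          rw [ih _ (not_le.1 hlt)]
          exact ⟨hα, rfl⟩
        · rw [ih _ j.isLt] at hj
          have := hj.2
          omega
      rw [layer, hX]
      have hmax {α : ℕ × ℕ} (h : α ∉ T)
          (hα : gapCount (T : Set (ℕ × ℕ)) D α.1 α.2 = i + 1) :
          α ∈ maxPart {α | α ∉ T ∧ i + 1 ≤ gapCount (T : Set (ℕ × ℕ)) D α.1 α.2} := by
        refine ⟨⟨h, hα.ge⟩, fun β hβ hle ↦ ?_⟩
        obtain rfl | ⟨h1, h2⟩ := hle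
        · rfl
        · have := hT.gapCount_lt_of_notMem hD h
          have := hT.gapCount_anti hD (Nat.succ_le_of_lt h1) (Nat.succ_le_of_lt h2)
          have := hβ.2
          simp only [Nat.succ_eq_add_one] at *
          omega
      ext ⟨a, b⟩
      constructor
      · rintro ⟨⟨⟨h, hle⟩, hm⟩, hC⟩
        refine ⟨h, ?_⟩
        -- If the count exceeds `i + 1`, maximality forces it to be at most `i` at `(a + 1, b + 1)`.
        -- A diagonal step loses at most 2, so the count is `i + 2` and both rays miss `T`. Then `(a
        -- + 1, b)` and `(a, b + 1)` are gaps of count `i + 1` with minimum `(a, b)`.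
        by_contra hne
        refine hC ⟨⟨⟨h, hle⟩, hm⟩, ?_⟩
        simp only at hle hne
        have hdiag := hT.gapCount_diag hD h
        have hlt : gapCount (T : Set (ℕ × ℕ)) D (a + 1) (b + 1) < i + 1 := by
          by_contra! hge
          obtain ⟨x, y, hx, hy, hxy, hc⟩ := hT.exists_gapCount_eq hD (Nat.succ_pos i) hge
          have := hm (x, y) ⟨hxy, hc.ge⟩ (Or.inr ⟨hx, hy⟩)
          simp at this
          omega
        have hv := verticalGap_le_one (T := (T : Set (ℕ × ℕ))) (a := a) (b := b)
        have hh := horizontalGap_le_one (T := (T : Set (ℕ × ℕ))) (a := a) (b := b)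
        have h1 := gapCount_fst hD a b
        have h2 := hT.gapCount_snd hD a b
        have hv1 : (a, b + 1) ∉ T := fun hmem ↦ by
          have := verticalGap_eq_zero (T := (T : Set (ℕ × ℕ))) ⟨b + 1, Nat.le_succ b, hmem⟩
          omega
        have hh1 : (a + 1, b) ∉ T := fun hmem ↦ by
          have := horizontalGap_eq_zero (T := (T : Set (ℕ × ℕ))) ⟨a + 1, Nat.le_succ a, hmem⟩
          omega
        exact ⟨(a + 1, b), ⟨hmax hh1 (by simp only; omega), by simp⟩, (a, b + 1),
          ⟨hmax hv1 (by simp only; omega), by simp⟩, by simp [Prod.mk_inf_mk]⟩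
      · rintro ⟨h, hc⟩
        refine ⟨hmax h hc, ?_⟩
        rintro ⟨-, ⟨p, q⟩, ⟨⟨⟨hβ, hcβ⟩, -⟩, hβne⟩, ⟨r, s⟩, ⟨⟨⟨hγ, hcγ⟩, -⟩, hγne⟩, hmin⟩
        simp only [Prod.mk_inf_mk, Prod.mk.injEq, mem_singleton_iff] at hmin hβne hγne hc hcβ hcγ
        -- Two points with minimum `(a, b)` lie on its two rays. If neither has smaller count, the
        -- first step along each ray costs 0, which forces `(a, b) ∈ T`.
        have key (x y : ℕ) (hx : a < x) (hy : b < y)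
            (h1 : i + 1 ≤ gapCount (T : Set (ℕ × ℕ)) D x b)
            (h2 : i + 1 ≤ gapCount (T : Set (ℕ × ℕ)) D a y) : False := by
          have := hT.gapCount_anti hD (Nat.succ_le_of_lt hx) (le_refl b)
          have := hT.gapCount_anti hD (le_refl a) (Nat.succ_le_of_lt hy)
          have := gapCount_fst hD a b
          have := hT.gapCount_snd hD a b
          have := hT.one_le_gaps_of_notMem h
          simp only [Nat.succ_eq_add_one] at *
          omega
        obtain ⟨ha, hb⟩ := hmin
        rcases le_total p r with hpr | hpr
        · obtain rfl : a = p := by omega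
          obtain rfl : b = s := by omega
          exact key r q (by omega) (by omega) hcγ hcβ
        · obtain rfl : a = r := by omega
          obtain rfl : b = q := by omega
          exact key p s (by omega) (by omega) hcβ hcγ

theorem isLevelNumber (hT : IsGoodSemigroup T) (hD : ∀ β, D + β ∈ T) :
    IsLevelNumber (univ \ (T : Set (ℕ × ℕ))) (gapCount (T : Set (ℕ × ℕ)) D 0 0) := by
  refine ⟨?_, fun i hi ↦ ?_, fun i hi j hj hij ↦ ?_⟩
  · ext ⟨a, b⟩
    simp only [mem_sdiff, mem_univ, true_and, SetLike.mem_coe, mem_iUnion, level,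
      hT.layer_compl hD, mem_ofPred_eq]
    refine ⟨fun h ↦ ?_, fun ⟨i, hi, h, _⟩ ↦ h⟩
    have := hT.gapCount_lt_of_notMem hD h
    have := hT.gapCount_anti hD (Nat.zero_le a) (Nat.zero_le b)
    exact ⟨gapCount (T : Set (ℕ × ℕ)) D 0 0 + 1 - gapCount (T : Set (ℕ × ℕ)) D a b,
      ⟨by omega, by omega⟩, h, by omega⟩
  · rw [level, hT.layer_compl hD]
    obtain ⟨x, y, -, -, hxy⟩ := hT.exists_gapCount_eq hD (a := 0) (b := 0)
      (i := gapCount (T : Set (ℕ × ℕ)) D 0 0 + 1 - i) (by have := hi.2; omega)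
      (by have := hi.1; omega)
    exact ⟨(x, y), hxy⟩
  · simp only [Function.onFun, level, hT.layer_compl hD]
    rw [Set.disjoint_left]
    rintro α ⟨-, h1⟩ ⟨-, h2⟩
    have := hi.1
    have := hi.2
    have := hj.1
    have := hj.2
    omega

end IsGoodSemigroup

/-! ### Uniqueness of the genus and of the number of levels. -/

theorem IsChainDist.unique {E : Set (ℕ × ℕ)} {α β : ℕ × ℕ} {m n : ℕ}
    (hm : IsChainDist E α β m) (hn : IsChainDist E α β n) : m = n :=
  hn.2 m hm.1

theorem IsSetDist.unique {E F : Set (ℕ × ℕ)} {k l : ℤ} (hk : IsSetDist E F k)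
    (hl : IsSetDist E F l) : k = l := by
  obtain ⟨e, f, he, hf, ⟨α, hα⟩, h⟩ := hk
  obtain ⟨e', f', he', hf', -, h'⟩ := hl
  obtain rfl := he.unique he'
  obtain rfl := hf.unique hf'
  obtain ⟨m, n, hm, hn, rfl⟩ := h α hα
  obtain ⟨m', n', hm', hn', rfl⟩ := h' α hα
  rw [hm.unique hm', hn.unique hn']

/-- If `N < M`, layer `N + 1` is nonempty, although layers `1, …, N` already exhaust `A`. -/
theorem IsLevelNumber.le {A : Set (ℕ × ℕ)} {M N : ℕ} (hM : IsLevelNumber A M)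
    (hN : IsLevelNumber A N) : M ≤ N := by
  by_contra! hlt
  obtain ⟨α, hα⟩ := hM.2.1 (M - N) ⟨by omega, by omega⟩
  rw [level, show M + 1 - (M - N) = N + 1 by omega, layer] at hα
  obtain ⟨hA, hU⟩ := hα.1.1
  rw [hN.1] at hA
  simp only [mem_iUnion] at hA
  obtain ⟨i, hi, hm⟩ := hA
  have := hi.1
  exact hU (mem_iUnion.2 ⟨⟨N + 1 - i, by omega⟩, hm⟩)

theorem IsLevelNumber.unique {A : Set (ℕ × ℕ)} {M N : ℕ} (hM : IsLevelNumber A M)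
    (hN : IsLevelNumber A N) : M = N :=
  le_antisymm (hM.le hN) (hN.le hM)

/-- For a good semigroup `T ⊆ ℕ²`, the distance `d(ℕ² ∖ T)` and the number of levels of `ℕ² ∖ T`
are well defined, and `g(T) = NL(ℕ² ∖ T)`. -/
theorem mainTheorem10 (T : AddSubmonoid (ℕ × ℕ)) (hT : IsGoodSemigroup T) :
    (∃! k : ℤ, IsSetDist univ (T : Set (ℕ × ℕ)) k) ∧
    (∃! N : ℕ, IsLevelNumber (univ \ (T : Set (ℕ × ℕ))) N) ∧
    genus T = (numLevels (univ \ (T : Set (ℕ × ℕ))) : ℤ) := by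
  obtain ⟨D, hD⟩ := hT.exists_cone
  have hg := hT.isSetDist hD
  have hN := hT.isLevelNumber hD
  refine ⟨⟨_, hg, fun _ h ↦ h.unique hg⟩, ⟨_, hN, fun _ h ↦ h.unique hN⟩, ?_⟩
  have h1 : IsSetDist univ (T : Set (ℕ × ℕ)) (genus T) := Classical.epsilon_spec ⟨_, hg⟩
  have h2 : IsLevelNumber (univ \ (T : Set (ℕ × ℕ))) (numLevels (univ \ (T : Set (ℕ × ℕ)))) :=
    Classical.epsilon_spec ⟨_, hN⟩
  rw [h1.unique hg, h2.unique hN]
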